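/- Let $G=(C\cup S,E)$ be a finite bipartite graph with clients $C$, $|C|=n$, and servers $S$. The servers are given in advance, and the clients arrive one at a time, in arbitrary order, each together with all its incident edges. Consider the following protocol for constructing a matching $M$, starting from $M=\emptyset$. When a client $c$ arrives, if the current graph (on $S$ and the clients that have arrived so far, including $c$) contains an augmenting path from $c$, that is, a path from $c$ to a server whose two endpoints are not matched by $M$ and whose edges alternate between edges outside $M$ and edges of $M$, then choose such a path with the fewest edges (ties are broken arbitrarily) and flip the status (in $M$ or not in $M$) of every edge on it; otherwise leave $M$ unchanged. Then for every real $h>0$, where $h\ge 1$ is required if $n=1$, the protocol uses in total at most $\dfrac{4n\ln(n)}{h}$ augmenting paths of length (number of edges) greater than $h$. -/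

import Mathlib

namespace OnlineMatching

/-- The bipartite graph on clients `C` and servers `S` whose edges are given by `E`. -/
def bipartiteGraph {C S : Type*} (E : C → S → Prop) : SimpleGraph (C ⊕ S) where
  Adj
    | Sum.inl c, Sum.inr s => E c s
    | Sum.inr s, Sum.inl c => E c s
    | _, _ => False
  symm := ⟨by rintro (c | s) (c' | s') h <;> exact h⟩
  loopless := ⟨by rintro (c | s) h <;> exact h⟩

/-- The current graph right after the arrival of client `σ t`: it has the edges of the clients
`σ 0, …, σ t`. Clients that have not arrived are kept as isolated vertices. -/
def currentGraph {C S : Type*} {n : ℕ} (E : C → S → Prop) (σ : Fin n ≃ C) (t : Fin n) :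
    SimpleGraph (C ⊕ S) :=
  bipartiteGraph fun c s => σ.symm c ≤ t ∧ E c s

/-- The vertex `v` is unmatched (free) with respect to the edge set `M`. -/
def IsFree {V : Type*} (M : Set (Sym2 V)) (v : V) : Prop :=
  ∀ e ∈ M, v ∉ e

/-- `p` is an augmenting path for `M`: a path whose edges alternate between edges outside `M` and
edges of `M`, and which starts and ends at distinct free vertices. -/
structure IsAugmenting {V : Type*} {G : SimpleGraph V} (M : Set (Sym2 V)) {u v : V}
    (p : G.Walk u v) : Prop where
  isPath : p.IsPath
  alternating : p.edges.IsChain fun e f => ¬(e ∈ M ↔ f ∈ M)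
  ne : u ≠ v
  free_start : IsFree M u
  free_end : IsFree M v

/-- A path from the client `c` to some server. -/
abbrev PathFrom {C S : Type*} (G : SimpleGraph (C ⊕ S)) (c : C) :=
  Σ s : S, G.Walk (Sum.inl c) (Sum.inr s)

/-- `p` is a shortest one among all augmenting paths from the client `c` to a free server. -/
def IsShortestAugmenting {C S : Type*} {G : SimpleGraph (C ⊕ S)} (M : Set (Sym2 (C ⊕ S))) {c : C}
    (p : PathFrom G c) : Prop :=
  IsAugmenting M p.2 ∧ ∀ q : PathFrom G c, IsAugmenting M q.2 → p.2.length ≤ q.2.length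

/-- The shortest augmenting path protocol on the graph `E` with clients arriving in the order
`σ 0, σ 1, …`. Here `M t` is the matching held just before the arrival of `σ t` (and `M (last n)`
the final one), and `P t` is the path used at the arrival of `σ t`, or `none` if there is none.
Ties between shortest augmenting paths may be broken in any way. -/
structure IsSAPRun {C S : Type*} {n : ℕ} (E : C → S → Prop) (σ : Fin n ≃ C)
    (M : Fin (n + 1) → Set (Sym2 (C ⊕ S)))
    (P : (t : Fin n) → Option (PathFrom (currentGraph E σ t) (σ t))) : Prop where
  /-- Initially nothing is matched. -/
  init : M 0 = ∅
  /-- If no path is used, then there is no augmenting path, and the matching does not change. -/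
  skip : ∀ t, P t = none →
    (∀ q : PathFrom (currentGraph E σ t) (σ t), ¬IsAugmenting (M t.castSucc) q.2) ∧
      M t.succ = M t.castSucc
  /-- If a path is used, it is a shortest augmenting one, and all of its edges are flipped. -/
  augment : ∀ t p, P t = some p →
    IsShortestAugmenting (M t.castSucc) p ∧
      M t.succ = symmDiff (M t.castSucc) {e | e ∈ p.2.edges}

end OnlineMatching

/-! Fix `0 < β ≤ 1`, let `A` be the set of currently matched clients, and choose a server set `T`
maximizing the surplus: the number of clients of `A` with all servers in `T`, minus `β * #T`. If the
arriving client has a server outside `T`, search from it by alternating paths avoiding `T`. Until a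
free server appears, each layer of servers is at least `1 / β` times the previous one, since
otherwise adding the next layer to `T` would raise the surplus (`card_layer_le`). As matched servers
number at most `#A`, `β ^ r * #A < 1` forces an augmenting path of length at most `2 * r + 1`. So a
client using a longer path has all its servers in `T`, and its arrival raises the maximum surplus by
at least one. The surplus never exceeds `(1 - β) * #A` (`surplus_le`), hence at most `(1 - β) * n`
paths are longer than `2 * r + 1` (`IsSAPRun.ncard_longTimes_le`). Taking `β = n ^ (-1 / r)` with
`r` about `h / 2` gives the bound; small `h` and `n` are separate cases. -/

namespace OnlineMatching

open Finset

/-! ### Matchings and flipping an augmenting path. -/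

section Matching

variable {C S : Type*}

/-- The edges matching each client `c ∈ A` to the server `m c`. -/
def matchingEdges (A : Finset C) (m : C → S) : Set (Sym2 (C ⊕ S)) :=
  {e | ∃ c ∈ A, s(Sum.inl c, Sum.inr (m c)) = e}

lemma mk_mem_matchingEdges {A : Finset C} {m : C → S} {c : C} {s : S} :
    s(Sum.inl c, Sum.inr s) ∈ matchingEdges A m ↔ c ∈ A ∧ m c = s := by
  constructor
  · rintro ⟨c', hc', h⟩
    simp only [Sym2.eq_iff, Sum.inl.injEq, Sum.inr.injEq, reduceCtorEq, and_self, or_false] at h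
    obtain ⟨rfl, rfl⟩ := h
    exact ⟨hc', rfl⟩
  · rintro ⟨hc, rfl⟩
    exact ⟨c, hc, rfl⟩

lemma isFree_inl_iff {A : Finset C} {m : C → S} {c : C} :
    IsFree (matchingEdges A m) (Sum.inl c) ↔ c ∉ A := by
  constructor
  · intro h hc
    exact h _ ⟨c, hc, rfl⟩ (by simp)
  · rintro h _ ⟨c', hc', rfl⟩
    simp only [Sym2.mem_iff, Sum.inl.injEq, reduceCtorEq, or_false]
    rintro rfl
    exact h hc'

lemma isFree_inr_iff {A : Finset C} {m : C → S} {s : S} :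
    IsFree (matchingEdges A m) (Sum.inr s) ↔ ∀ c ∈ A, m c ≠ s := by
  constructor
  · rintro h c hc rfl
    exact h _ ⟨c, hc, rfl⟩ (by simp)
  · rintro h _ ⟨c', hc', rfl⟩
    simp only [Sym2.mem_iff, Sum.inr.injEq, reduceCtorEq, false_or]
    rintro rfl
    exact h c' hc' rfl

lemma mem_matchingEdges_insert_iff [DecidableEq C] {A : Finset C} {m : C → S} {c : C} {s : S}
    (hc : c ∉ A) (e : Sym2 (C ⊕ S)) :
    e ∈ matchingEdges (insert c A) (Function.update m c s) ↔
      e ∈ matchingEdges A m ∨ e = s(Sum.inl c, Sum.inr s) := by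
  constructor
  · rintro ⟨c', hc', rfl⟩
    rcases eq_or_ne c' c with rfl | hne
    · right; simp
    · left
      rw [Function.update_of_ne hne, mk_mem_matchingEdges]
      exact ⟨(Finset.mem_insert.1 hc').resolve_left hne, rfl⟩
  · rintro (⟨c', hc', rfl⟩ | rfl)
    · have hne : c' ≠ c := by rintro rfl; exact hc hc'
      rw [mk_mem_matchingEdges, Function.update_of_ne hne]
      exact ⟨Finset.mem_insert_of_mem hc', rfl⟩
    · rw [mk_mem_matchingEdges]
      simp

/-- Flipping an augmenting path (with respect to `M₀`, which agrees on the path with the given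
matching) gives a matching that covers one more client. -/
lemma exists_matchingEdges_symmDiff [DecidableEq C] {F : C → S → Prop}
    {M₀ : Set (Sym2 (C ⊕ S))} {v : S} (N : ℕ) :
    ∀ (A : Finset C) (m : C → S) (c : C) (p : (bipartiteGraph F).Walk (Sum.inl c) (Sum.inr v)),
      p.length ≤ N → p.IsPath → (p.edges.IsChain fun e f => ¬(e ∈ M₀ ↔ f ∈ M₀)) →
      (∀ e ∈ p.edges, e ∈ M₀ ↔ e ∈ matchingEdges A m) →
      Set.InjOn m A → (∀ c ∈ A, F c (m c)) → c ∉ A → (∀ c ∈ A, m c ≠ v) →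
      ∃ m' : C → S, Set.InjOn m' (insert c A : Finset C) ∧
        (∀ c' ∈ insert c A, F c' (m' c')) ∧
        symmDiff (matchingEdges A m) {e | e ∈ p.edges} = matchingEdges (insert c A) m' := by
  induction N with
  | zero =>
    intro A m c p hp
    cases p with
    | cons h q => simp at hp
  | succ N ih =>
    intro A m c p hlen hpath hchain hagree hinj hF hc hv
    cases p with
    | @cons _ w _ h q =>
    rcases w with c' | s
    · exact h.elim
    have hcs : F c s := h
    cases q with
    | nil =>
      refine ⟨Function.update m c v, ?_, ?_, ?_⟩
      · intro a ha b hb hab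
        simp only [coe_insert, Set.mem_insert_iff, mem_coe] at ha hb
        by_cases hac : a = c <;> by_cases hbc : b = c
        · rw [hac, hbc]
        · subst hac
          rw [Function.update_self, Function.update_of_ne hbc] at hab
          exact absurd hab.symm (hv b (hb.resolve_left hbc))
        · subst hbc
          rw [Function.update_self, Function.update_of_ne hac] at hab
          exact absurd hab (hv a (ha.resolve_left hac))
        · rw [Function.update_of_ne hac, Function.update_of_ne hbc] at hab
          exact hinj (ha.resolve_left hac) (hb.resolve_left hbc) hab
      · intro c' hc'
        by_cases hcc : c' = c
        · subst hcc; simpa using hcs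
        · rw [Function.update_of_ne hcc]
          exact hF _ ((Finset.mem_insert.1 hc').resolve_left hcc)
      · ext e
        rw [mem_matchingEdges_insert_iff hc, Set.mem_symmDiff]
        have : s(Sum.inl c, Sum.inr v) ∉ matchingEdges A m := fun h =>
          hc (mk_mem_matchingEdges.1 h).1
        simp only [SimpleGraph.Walk.edges_cons, SimpleGraph.Walk.edges_nil, List.mem_singleton,
          Set.mem_ofPred_eq]
        constructor
        · tauto
        · rintro (h | rfl)
          · exact Or.inl ⟨h, fun h' => this (h' ▸ h)⟩
          · exact Or.inr ⟨rfl, this⟩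
    | @cons _ w _ h' q =>
      rcases w with c' | s'
      swap
      · exact h'.elim
      -- The first edge is unmatched because `c` is, so alternation makes the second edge the one
      -- matching `c'` to `s`.
      have e1 : s(Sum.inl c, Sum.inr s) ∉ matchingEdges A m := fun h =>
        hc (mk_mem_matchingEdges.1 h).1
      have e2 : s(Sum.inl c', Sum.inr s) ∈ matchingEdges A m := by
        have h1 := hagree s(Sum.inl c, Sum.inr s) (by simp)
        have h2 := hagree s(Sum.inl c', Sum.inr s) (by simp [Sym2.eq_swap])
        simp only [SimpleGraph.Walk.edges_cons, List.isChain_cons_cons] at hchain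
        have h3 := hchain.1
        rw [Sym2.eq_swap (a := Sum.inr s)] at h3
        tauto
      obtain ⟨hc', hms⟩ := mk_mem_matchingEdges.1 e2
      have hcc' : c' ≠ c := by rintro rfl; exact hc hc'
      have htrail := hpath.isTrail.edges_nodup
      simp only [SimpleGraph.Walk.edges_cons, List.nodup_cons, List.mem_cons, not_or] at htrail
      obtain ⟨⟨hne12, hn1⟩, hn2, -⟩ := htrail
      rw [Sym2.eq_swap (a := Sum.inr s)] at hne12 hn2
      have hsv : s ≠ v := by
        rintro rfl
        rw [SimpleGraph.Walk.cons_isPath_iff, SimpleGraph.Walk.cons_isPath_iff] at hpath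
        exact hpath.1.2 (SimpleGraph.Walk.end_mem_support q)
      -- Flipping the first two edges hands `s` over to `c` and frees `c'`. The rest `q` avoids both
      -- edges, so the new matching still agrees with `M₀` on `q`, and the induction continues from
      -- `c'`.
      have key : ∀ e, e ∈ matchingEdges ((insert c A).erase c') (Function.update m c s) ↔
          (e ∈ matchingEdges A m ∧ e ≠ s(Sum.inl c', Sum.inr s)) ∨
            e = s(Sum.inl c, Sum.inr s) := by
        intro e
        constructor
        · rintro ⟨a, ha, rfl⟩
          rw [Finset.mem_erase, Finset.mem_insert] at ha
          rcases eq_or_ne a c with rfl | hac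
          · right; simp
          · left
            rw [Function.update_of_ne hac]
            refine ⟨⟨a, ha.2.resolve_left hac, rfl⟩, ?_⟩
            simp only [ne_eq, Sym2.eq_iff, Sum.inl.injEq, reduceCtorEq]
            tauto
        · rintro (⟨⟨a, ha, rfl⟩, hne⟩ | rfl)
          · have hac : a ≠ c := by rintro rfl; exact hc ha
            rw [mk_mem_matchingEdges, Function.update_of_ne hac, Finset.mem_erase,
              Finset.mem_insert]
            refine ⟨⟨?_, Or.inr ha⟩, rfl⟩
            rintro rfl
            exact hne (by rw [hms])
          · rw [mk_mem_matchingEdges, Finset.mem_erase]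
            simp [hcc'.symm]
      have hmem : ∀ a ∈ (insert c A).erase c', a ≠ c → a ∈ A ∧ a ≠ c' := by
        intro a ha hac
        rw [Finset.mem_erase, Finset.mem_insert] at ha
        exact ⟨ha.2.resolve_left hac, ha.1⟩
      have hinsert : insert c' ((insert c A).erase c') = insert c A :=
        Finset.insert_erase (Finset.mem_insert_of_mem hc')
      obtain ⟨m', h1, h2, h3⟩ := ih ((insert c A).erase c') (Function.update m c s) c' q
        (by simp only [SimpleGraph.Walk.length_cons] at hlen; omega)
        hpath.of_cons.of_cons
        (by simp only [SimpleGraph.Walk.edges_cons] at hchain; exact hchain.tail.tail)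
        (by
          intro e he
          have hne1 : e ≠ s(Sum.inl c, Sum.inr s) := by rintro rfl; exact hn1 he
          have hne2 : e ≠ s(Sum.inl c', Sum.inr s) := by rintro rfl; exact hn2 he
          rw [hagree e (by simp [he]), key]
          tauto)
        (by
          intro a ha b hb hab
          rw [mem_coe] at ha hb
          by_cases hac : a = c <;> by_cases hbc : b = c
          · rw [hac, hbc]
          · have hb' := hmem b hb hbc
            rw [hac, Function.update_self, Function.update_of_ne hbc] at hab
            exact absurd (hinj hb'.1 hc' (hab.symm.trans hms.symm)) hb'.2
          · have ha' := hmem a ha hac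
            rw [hbc, Function.update_self, Function.update_of_ne hac] at hab
            exact absurd (hinj ha'.1 hc' (hab.trans hms.symm)) ha'.2
          · rw [Function.update_of_ne hac, Function.update_of_ne hbc] at hab
            exact hinj (hmem a ha hac).1 (hmem b hb hbc).1 hab)
        (by
          intro a ha
          by_cases hac : a = c
          · rw [hac, Function.update_self]; exact hcs
          · rw [Function.update_of_ne hac]; exact hF a (hmem a ha hac).1)
        (by simp)
        (by
          intro a ha
          by_cases hac : a = c
          · rw [hac, Function.update_self]; exact hsv
          · rw [Function.update_of_ne hac]; exact hv a (hmem a ha hac).1)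
      rw [hinsert] at h1 h2 h3
      refine ⟨m', h1, h2, h3 ▸ ?_⟩
      ext e
      simp only [Set.mem_symmDiff, key, SimpleGraph.Walk.edges_cons, List.mem_cons,
        Set.mem_ofPred_eq, Sym2.eq_swap (a := (Sum.inr s : C ⊕ S))]
      by_cases hx1 : e = s(Sum.inl c, Sum.inr s)
      · subst hx1; tauto
      by_cases hx2 : e = s(Sum.inl c', Sum.inr s)
      · subst hx2; tauto
      tauto

/-! ### Layers of alternating search. -/

/-- The servers outside `T` that an alternating walk avoiding `T` reaches from `s₀` through at most
`k` clients of `A`. -/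
noncomputable def layer [Fintype S] [DecidableEq S] (F : C → S → Prop) (A : Finset C) (m : C → S)
    (T : Finset S) (s₀ : S) : ℕ → Finset S
  | 0 => {s₀}
  | k + 1 => by
    classical
    exact layer F A m T s₀ k ∪
      univ.filter fun s => s ∉ T ∧ ∃ c ∈ A, m c ∈ layer F A m T s₀ k ∧ F c s

section Layer

variable [Fintype S] [DecidableEq S] {F : C → S → Prop} {A : Finset C} {m : C → S}
  {T : Finset S} {s₀ : S}

lemma mem_layer_succ {k : ℕ} {s : S} :
    s ∈ layer F A m T s₀ (k + 1) ↔ s ∈ layer F A m T s₀ k ∨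
      (s ∉ T ∧ ∃ c ∈ A, m c ∈ layer F A m T s₀ k ∧ F c s) := by
  simp [layer]

lemma notMem_of_mem_layer (hs₀ : s₀ ∉ T) {k : ℕ} {s : S} (hs : s ∈ layer F A m T s₀ k) :
    s ∉ T := by
  induction k with
  | zero =>
    simp only [layer, Finset.mem_singleton] at hs
    exact hs ▸ hs₀
  | succ k ih =>
    rcases mem_layer_succ.1 hs with h | h
    · exact ih h
    · exact h.1

/-- The path is built backwards from `v`, one layer per step. The last two hypotheses keep the tail
`q` out of earlier layers, so the vertices prepended to it are new and the walk remains a path. -/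
lemma exists_isAugmenting_of_tail {c₀ : C} (hc₀ : c₀ ∉ A) (h₀ : F c₀ s₀)
    (hF : ∀ c ∈ A, F c (m c)) {v : S} (hv : ∀ c ∈ A, m c ≠ v) (j : ℕ) :
    ∀ (s : S) (q : (bipartiteGraph F).Walk (Sum.inr s) (Sum.inr v)),
      s ∈ layer F A m T s₀ j → q.IsPath →
      (q.edges.IsChain fun e f => ¬(e ∈ matchingEdges A m ↔ f ∈ matchingEdges A m)) →
      (∀ e ∈ q.edges.head?, e ∈ matchingEdges A m) →
      (∀ s', Sum.inr s' ∈ q.support → ∀ i < j, s' ∉ layer F A m T s₀ i) →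
      (∀ c, Sum.inl c ∈ q.support → c ∈ A ∧ ∀ i < j, m c ∉ layer F A m T s₀ i) →
      ∃ p : (bipartiteGraph F).Walk (Sum.inl c₀) (Sum.inr v),
        IsAugmenting (matchingEdges A m) p ∧ p.length ≤ q.length + 2 * j + 1 := by
  induction j with
  | zero =>
    intro s q hs hq hchain hhead hserv hcl
    simp only [layer, Finset.mem_singleton] at hs
    subst hs
    have hadj : (bipartiteGraph F).Adj (Sum.inl c₀) (Sum.inr s) := h₀
    refine ⟨SimpleGraph.Walk.cons hadj q, ⟨?_, ?_, by simp, isFree_inl_iff.2 hc₀,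
      isFree_inr_iff.2 hv⟩, by simp⟩
    · exact hq.cons fun h => hc₀ (hcl _ h).1
    · rw [SimpleGraph.Walk.edges_cons, List.isChain_cons]
      refine ⟨fun e he => ?_, hchain⟩
      have := hhead e he
      rw [mk_mem_matchingEdges]
      tauto
  | succ j ih =>
    intro s q hs hq hchain hhead hserv hcl
    have hsj : ∀ i < j + 1, s ∉ layer F A m T s₀ i := hserv s (by simp)
    obtain ⟨hsT, c, hcA, hmc, hcs⟩ := (mem_layer_succ.1 hs).resolve_left (hsj j (by omega))
    have hadj1 : (bipartiteGraph F).Adj (Sum.inr (m c)) (Sum.inl c) := hF c hcA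
    have hadj2 : (bipartiteGraph F).Adj (Sum.inl c) (Sum.inr s) := hcs
    -- If `m c` appeared before layer `j`, then `s` would appear before layer `j + 1`.
    have hmcj : ∀ i < j, m c ∉ layer F A m T s₀ i := fun i hi h =>
      hsj (i + 1) (by omega) (mem_layer_succ.2 (Or.inr ⟨hsT, c, hcA, h, hcs⟩))
    have hne : m c ≠ s := fun h => hsj j (by omega) (h ▸ hmc)
    have hmcq : Sum.inr (m c) ∉ q.support := fun h => hserv _ h j (by omega) hmc
    have hcq : Sum.inl c ∉ q.support := fun h => (hcl _ h).2 j (by omega) hmc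
    have e1 : s(Sum.inr (m c), Sum.inl c) ∈ matchingEdges A m := by
      rw [Sym2.eq_swap, mk_mem_matchingEdges]; exact ⟨hcA, rfl⟩
    have e2 : s(Sum.inl c, Sum.inr s) ∉ matchingEdges A m := by
      rw [mk_mem_matchingEdges]; tauto
    obtain ⟨p, hp, hlen⟩ := ih (m c)
      (SimpleGraph.Walk.cons hadj1 (SimpleGraph.Walk.cons hadj2 q)) hmc
      ((hq.cons hcq).cons (by simp [hmcq]))
      (by
        simp only [SimpleGraph.Walk.edges_cons]
        refine List.isChain_cons_cons.2 ⟨by tauto, List.isChain_cons.2 ⟨fun e he => ?_, hchain⟩⟩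
        have := hhead e he
        tauto)
      (by simpa using e1)
      (by
        intro s' hs' i hi
        simp only [SimpleGraph.Walk.support_cons, List.mem_cons, Sum.inr.injEq, reduceCtorEq,
          false_or] at hs'
        rcases hs' with rfl | hs'
        · exact hmcj i hi
        · exact hserv s' hs' i (by omega))
      (by
        intro c' hc'
        simp only [SimpleGraph.Walk.support_cons, List.mem_cons, Sum.inl.injEq, reduceCtorEq,
          false_or] at hc'
        rcases hc' with rfl | hc'
        · exact ⟨hcA, hmcj⟩
        · exact ⟨(hcl c' hc').1, fun i hi => (hcl c' hc').2 i (by omega)⟩)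
    refine ⟨p, hp, ?_⟩
    simp only [SimpleGraph.Walk.length_cons] at hlen
    omega

lemma exists_isAugmenting {c₀ : C} (hc₀ : c₀ ∉ A) (h₀ : F c₀ s₀)
    (hF : ∀ c ∈ A, F c (m c)) {v : S} (hv : ∀ c ∈ A, m c ≠ v) {k : ℕ}
    (hk : v ∈ layer F A m T s₀ k) :
    ∃ p : (bipartiteGraph F).Walk (Sum.inl c₀) (Sum.inr v),
      IsAugmenting (matchingEdges A m) p ∧ p.length ≤ 2 * k + 1 := by
  classical
  -- At the first layer containing `v`, the trivial walk at `v` is an admissible tail.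
  have hex : ∃ j, v ∈ layer F A m T s₀ j := ⟨k, hk⟩
  obtain ⟨p, hp, hlen⟩ := exists_isAugmenting_of_tail hc₀ h₀ hF hv (Nat.find hex) v
    SimpleGraph.Walk.nil (Nat.find_spec hex) (by simp) (by simp) (by simp)
    (by
      intro s' hs' i hi
      simp only [SimpleGraph.Walk.support_nil, List.mem_singleton, Sum.inr.injEq] at hs'
      exact hs' ▸ Nat.find_min hex hi)
    (by simp)
  have := Nat.find_min' hex hk
  refine ⟨p, hp, ?_⟩
  simp only [SimpleGraph.Walk.length_nil] at hlen
  omega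

end Layer

/-! ### Surplus and expansion of the layers. -/

open Classical in
/-- The number of clients of `A` all of whose servers lie in `T`, minus `β` for each server
of `T`. -/
noncomputable def surplus (E : C → S → Prop) (β : ℝ) (A : Finset C) (T : Finset S) : ℝ :=
  #{c ∈ A | ∀ s, E c s → s ∈ T} - β * #T

lemma surplus_eq {E : C → S → Prop} {β : ℝ} {A : Finset C} {T : Finset S}
    [DecidablePred fun c => ∀ s, E c s → s ∈ T] :
    surplus E β A T = #{c ∈ A | ∀ s, E c s → s ∈ T} - β * #T := by
  unfold surplus
  congr!

lemma surplus_mono {E : C → S → Prop} {β : ℝ} {A B : Finset C} (h : A ⊆ B) (T : Finset S) :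
    surplus E β A T ≤ surplus E β B T := by
  classical
  unfold surplus
  gcongr

lemma surplus_insert [DecidableEq C] {E : C → S → Prop} {β : ℝ} {A : Finset C} {T : Finset S}
    {c : C} (hc : c ∉ A) (hT : ∀ s, E c s → s ∈ T) :
    surplus E β (insert c A) T = surplus E β A T + 1 := by
  classical
  unfold surplus
  rw [Finset.filter_insert, if_pos hT, Finset.card_insert_of_notMem (by simp [hc])]
  push_cast
  ring

/-- The `x` clients counted are matched injectively into `T`, so `x ≤ #T` and the surplus is at most
`(1 - β) * x`. -/
lemma surplus_le {E : C → S → Prop} {β : ℝ} (h0 : 0 ≤ β) (h1 : β ≤ 1) {A : Finset C}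
    {m : C → S} (hinj : Set.InjOn m A) (hE : ∀ c ∈ A, E c (m c)) (T : Finset S) :
    surplus E β A T ≤ (1 - β) * #A := by
  classical
  unfold surplus
  have hle : #{c ∈ A | ∀ s, E c s → s ∈ T} ≤ #T := by
    refine Finset.card_le_card_of_injOn m ?_ (hinj.mono (Finset.coe_subset.2 (Finset.filter_subset _ _)))
    intro c hc
    simp only [coe_filter, Set.mem_ofPred_eq] at hc
    exact hc.2 _ (hE c hc.1)
  have hle' : #{c ∈ A | ∀ s, E c s → s ∈ T} ≤ #A := Finset.card_filter_le _ _
  have a : (#{c ∈ A | ∀ s, E c s → s ∈ T} : ℝ) ≤ #T := by exact_mod_cast hle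
  have b : (#{c ∈ A | ∀ s, E c s → s ∈ T} : ℝ) ≤ #A := by exact_mod_cast hle'
  nlinarith

/-- Outside a set of servers of maximum surplus, the layers grow by a factor of `1 / β` as long as
they contain no free server. -/
lemma card_layer_le [Fintype S] [DecidableEq S] {E F : C → S → Prop} {β : ℝ} {A : Finset C}
    {m : C → S} {T : Finset S} {s₀ : S} (hE : ∀ c ∈ A, E c (m c))
    (hEF : ∀ c ∈ A, ∀ s, E c s → F c s)
    (hmax : ∀ T', surplus E β A T' ≤ surplus E β A T) (hs₀ : s₀ ∉ T) {k : ℕ}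
    (hmatched : ∀ s ∈ layer F A m T s₀ k, ∃ c ∈ A, m c = s) :
    (#(layer F A m T s₀ k) : ℝ) ≤ β * #(layer F A m T s₀ (k + 1)) := by
  classical
  -- Enlarging `T` by layer `k + 1` newly counts every client matched into layer `k`: its servers
  -- lie in `T` or layer `k + 1`, and its partner is outside `T`. By maximality this gain is at most
  -- the cost `β * #(layer F A m T s₀ (k + 1))`.
  have hT := hmax (T ∪ layer F A m T s₀ (k + 1))
  have hdisj : Disjoint T (layer F A m T s₀ (k + 1)) :=
    Finset.disjoint_right.2 fun s hs => notMem_of_mem_layer hs₀ hs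
  rw [surplus_eq, surplus_eq, Finset.card_union_of_disjoint hdisj] at hT
  have hlay : #(layer F A m T s₀ k) ≤ #{c ∈ A | m c ∈ layer F A m T s₀ k} := by
    refine (Finset.card_le_card ?_).trans (Finset.card_image_le (f := m))
    intro s hs
    obtain ⟨c, hc, rfl⟩ := hmatched s hs
    exact Finset.mem_image_of_mem _ (by simp [hc, hs])
  have hsub : #{c ∈ A | ∀ s, E c s → s ∈ T} + #{c ∈ A | m c ∈ layer F A m T s₀ k} ≤
      #{c ∈ A | ∀ s, E c s → s ∈ T ∪ layer F A m T s₀ (k + 1)} := by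
    rw [← Finset.card_union_of_disjoint]
    · refine Finset.card_le_card ?_
      intro c hc
      simp only [mem_union, mem_filter] at hc ⊢
      rcases hc with hc | hc
      · exact ⟨hc.1, fun s hs => Or.inl (hc.2 s hs)⟩
      · refine ⟨hc.1, fun s hs => ?_⟩
        by_cases hsT : s ∈ T
        · exact Or.inl hsT
        · exact Or.inr (mem_layer_succ.2 (Or.inr ⟨hsT, c, hc.1, hc.2, hEF c hc.1 s hs⟩))
    · rw [Finset.disjoint_filter]
      intro c hc h1 h2
      exact notMem_of_mem_layer hs₀ h2 (h1 _ (hE c hc))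
  have a : (#(layer F A m T s₀ k) : ℝ) ≤ #{c ∈ A | m c ∈ layer F A m T s₀ k} := by
    exact_mod_cast hlay
  have b : (#{c ∈ A | ∀ s, E c s → s ∈ T} : ℝ) + #{c ∈ A | m c ∈ layer F A m T s₀ k} ≤
      #{c ∈ A | ∀ s, E c s → s ∈ T ∪ layer F A m T s₀ (k + 1)} := by
    exact_mod_cast hsub
  push_cast at hT
  linarith

/-- If some server of `c₀` lies outside a set of maximum surplus, then there is a short augmenting
path from `c₀`. -/
lemma exists_short_isAugmenting [Fintype S] {E F : C → S → Prop} {β : ℝ}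
    (hβ : 0 < β) {A : Finset C} {m : C → S} {T : Finset S} {s₀ : S} {c₀ : C}
    (hE : ∀ c ∈ A, E c (m c)) (hEF : ∀ c ∈ A, ∀ s, E c s → F c s)
    (hmax : ∀ T', surplus E β A T' ≤ surplus E β A T) (hs₀ : s₀ ∉ T) (hc₀ : c₀ ∉ A)
    (h₀ : F c₀ s₀) {r : ℕ} (hr : β ^ r * #A < 1) :
    ∃ q : PathFrom (bipartiteGraph F) c₀,
      IsAugmenting (matchingEdges A m) q.2 ∧ q.2.length ≤ 2 * r + 1 := by
  classical
  by_cases hfree : ∃ k ≤ r, ∃ v ∈ layer F A m T s₀ k, ∀ c ∈ A, m c ≠ v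
  · obtain ⟨k, hk, v, hv, hvf⟩ := hfree
    obtain ⟨p, hp, hlen⟩ := exists_isAugmenting hc₀ h₀ (fun c hc => hEF c hc _ (hE c hc)) hvf hv
    exact ⟨⟨v, p⟩, hp, hlen.trans (by omega)⟩
  · push Not at hfree
    exfalso
    have hgrow : ∀ k ≤ r, 1 ≤ β ^ k * #(layer F A m T s₀ k) := by
      intro k
      induction k with
      | zero => intro; simp [layer]
      | succ k ih =>
        intro hk
        have h1 := ih (by omega)
        have h2 := card_layer_le hE hEF hmax hs₀ (hfree k (by omega))
        calc (1 : ℝ) ≤ β ^ k * #(layer F A m T s₀ k) := h1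
          _ ≤ β ^ k * (β * #(layer F A m T s₀ (k + 1))) := by gcongr
          _ = _ := by ring
    have hcard : #(layer F A m T s₀ r) ≤ #A := by
      refine (Finset.card_le_card ?_).trans (Finset.card_image_le (f := m))
      intro s hs
      obtain ⟨c, hc, rfl⟩ := hfree r le_rfl s hs
      exact Finset.mem_image_of_mem _ hc
    have hcard' : (#(layer F A m T s₀ r) : ℝ) ≤ #A := by exact_mod_cast hcard
    have := hgrow r le_rfl
    have : β ^ r * (#(layer F A m T s₀ r) : ℝ) ≤ β ^ r * #A := by gcongr
    linarith

end Matching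

/-! ### The protocol and the count of long paths. -/

section Run

variable {C S : Type*} {n : ℕ} {E : C → S → Prop} {σ : Fin n ≃ C}
  {M : Fin (n + 1) → Set (Sym2 (C ⊕ S))}
  {P : (t : Fin n) → Option (PathFrom (currentGraph E σ t) (σ t))}

open Classical in
/-- The clients among the first `j` for which a path was used. -/
noncomputable def accepted (σ : Fin n ≃ C)
    (P : (t : Fin n) → Option (PathFrom (currentGraph E σ t) (σ t))) (j : ℕ) : Finset C :=
  (univ.filter fun t : Fin n => t.val < j ∧ P t ≠ none).map σ.toEmbedding

lemma mem_accepted {j : ℕ} {t : Fin n} : σ t ∈ accepted σ P j ↔ t.val < j ∧ P t ≠ none := by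
  simp [accepted]

lemma symm_lt_of_mem_accepted {j : ℕ} {c : C} (hc : c ∈ accepted σ P j) :
    (σ.symm c).val < j := by
  rw [← σ.apply_symm_apply c] at hc
  exact (mem_accepted.1 hc).1

lemma card_accepted_le (j : ℕ) : #(accepted σ P j) ≤ j := by
  classical
  rw [accepted, Finset.card_map]
  refine (Finset.card_le_card_of_injOn (t := Finset.range j) (fun t : Fin n => t.val) ?_ ?_).trans
    (by simp)
  · intro t ht
    simp only [coe_filter, mem_univ, true_and, Set.mem_ofPred_eq] at ht
    simpa using ht.1
  · exact Fin.val_injective.injOn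

lemma accepted_succ_of_eq_none {t : Fin n} (h : P t = none) :
    accepted σ P (t + 1) = accepted σ P t := by
  ext c
  obtain ⟨i, rfl⟩ := σ.surjective c
  rw [mem_accepted, mem_accepted]
  constructor
  · rintro ⟨h1, h2⟩
    refine ⟨lt_of_le_of_ne (by omega) fun h3 => ?_, h2⟩
    rw [Fin.ext h3] at h2
    exact h2 h
  · rintro ⟨h1, h2⟩
    exact ⟨by omega, h2⟩

lemma accepted_succ_of_eq_some [DecidableEq C] {t : Fin n} {p} (h : P t = some p) :
    accepted σ P (t + 1) = insert (σ t) (accepted σ P t) := by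
  ext c
  obtain ⟨i, rfl⟩ := σ.surjective c
  rw [Finset.mem_insert, mem_accepted, mem_accepted, σ.injective.eq_iff]
  constructor
  · rintro ⟨h1, h2⟩
    by_cases h3 : i = t
    · exact Or.inl h3
    · have : i.val ≠ t.val := fun h4 => h3 (Fin.ext h4)
      exact Or.inr ⟨by omega, h2⟩
  · rintro (rfl | ⟨h1, h2⟩)
    · exact ⟨by omega, by simp [h]⟩
    · exact ⟨by omega, h2⟩

lemma notMem_accepted_self {t : Fin n} : σ t ∉ accepted σ P t := fun h =>
  lt_irrefl _ (mem_accepted.1 h).1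

/-- At all times, the protocol holds a matching of exactly the accepted clients. -/
lemma IsSAPRun.exists_matching [Nonempty S] (hrun : IsSAPRun E σ M P) (j : Fin (n + 1)) :
    ∃ m : C → S, Set.InjOn m (accepted σ P j) ∧ (∀ c ∈ accepted σ P j, E c (m c)) ∧
      M j = matchingEdges (accepted σ P j) m := by
  classical
  induction j using Fin.induction with
  | zero =>
    have h0 : accepted σ P (0 : Fin (n + 1)).val = ∅ :=
      Finset.card_eq_zero.1 (Nat.le_zero.1 (card_accepted_le 0))
    refine ⟨fun _ => Classical.arbitrary S, ?_⟩
    rw [h0, hrun.init]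
    simp [matchingEdges]
  | succ t ih =>
    obtain ⟨m, hinj, hE, hM⟩ := ih
    simp only [Fin.val_castSucc] at hinj hE hM
    simp only [Fin.val_succ]
    cases hP : P t with
    | none =>
      rw [accepted_succ_of_eq_none hP]
      exact ⟨m, hinj, hE, (hrun.skip t hP).2.trans hM⟩
    | some p =>
      obtain ⟨⟨haug, -⟩, hsucc⟩ := hrun.augment t p hP
      have hfree := haug.free_end
      rw [hM, isFree_inr_iff] at hfree
      obtain ⟨m', h1, h2, h3⟩ := exists_matchingEdges_symmDiff (M₀ := M t.castSucc) p.2.length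
        (accepted σ P t) m (σ t) p.2 le_rfl haug.isPath haug.alternating (by simp [hM]) hinj
        (fun c hc => ⟨Fin.le_def.2 (symm_lt_of_mem_accepted hc).le, hE c hc⟩)
        notMem_accepted_self hfree
      rw [accepted_succ_of_eq_some hP]
      refine ⟨m', h1, fun c hc => (h2 c hc).2, ?_⟩
      rw [hsucc, hM]
      exact h3

/-- If `T` has maximum surplus and a long path is used, then all servers of the arriving client
lie in `T`. -/
lemma IsSAPRun.mem_of_long [Nonempty S] [Fintype S] (hrun : IsSAPRun E σ M P) {β : ℝ}
    (hβ : 0 < β) {t : Fin n} {p : PathFrom (currentGraph E σ t) (σ t)} (hp : P t = some p)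
    {r : ℕ} (hlen : 2 * r + 1 < p.2.length) (hr : β ^ r * #(accepted σ P t) < 1) {T : Finset S}
    (hmax : ∀ T', surplus E β (accepted σ P t) T' ≤ surplus E β (accepted σ P t) T) {s : S}
    (hs : E (σ t) s) : s ∈ T := by
  obtain ⟨m, -, hE, hM⟩ := hrun.exists_matching t.castSucc
  simp only [Fin.val_castSucc] at hE hM
  by_contra hsT
  obtain ⟨q, hq, hqlen⟩ := exists_short_isAugmenting
    (F := fun c s => σ.symm c ≤ t ∧ E c s) hβ hE
    (fun c hc s hs => ⟨Fin.le_def.2 (symm_lt_of_mem_accepted hc).le, hs⟩) hmax hsT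
    notMem_accepted_self ⟨by simp, hs⟩ hr
  have hle := ((hrun.augment t p hp).1.2 q (by rw [hM]; exact hq)).trans hqlen
  omega

/-- The arrivals at which a path longer than `ℓ` is used. -/
def longTimes (P : (t : Fin n) → Option (PathFrom (currentGraph E σ t) (σ t))) (ℓ : ℝ) :
    Set (Fin n) :=
  {t | ∃ p, P t = some p ∧ ℓ < (p.2.length : ℝ)}

lemma longTimes_anti {ℓ ℓ' : ℝ} (h : ℓ ≤ ℓ') : longTimes P ℓ' ⊆ longTimes P ℓ := by
  rintro t ⟨p, hp, hlt⟩
  exact ⟨p, hp, h.trans_lt hlt⟩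

/-- The maximum surplus serves as a potential: it never decreases, and every long path raises it by
at least one. -/
lemma IsSAPRun.ncard_longTimes_le [Nonempty S] [Finite S] (hrun : IsSAPRun E σ M P) {β : ℝ}
    (h0 : 0 < β) (h1 : β ≤ 1) {r : ℕ} (hr : β ^ r * n ≤ 1) :
    ((longTimes P (2 * r + 1)).ncard : ℝ) ≤ (1 - β) * n := by
  classical
  have := Fintype.ofFinite S
  have key : ∀ j : Fin (n + 1), ∃ T : Finset S,
      (#{t : Fin n | t.val < j.val ∧ t ∈ longTimes P (2 * r + 1)} : ℝ) ≤
        surplus E β (accepted σ P j) T := by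
    intro j
    induction j using Fin.induction with
    | zero => exact ⟨∅, by simp [surplus]⟩
    | succ t ih =>
      obtain ⟨T₀, hT₀⟩ := ih
      obtain ⟨T, hT⟩ := Finite.exists_max (surplus E β (accepted σ P t))
      have hTge := hT₀.trans (hT T₀)
      simp only [Fin.val_castSucc] at hTge
      refine ⟨T, ?_⟩
      simp only [Fin.val_succ]
      by_cases hlong : t ∈ longTimes P (2 * r + 1)
      · obtain ⟨p, hp, hlt⟩ := hlong
        have hlt' : 2 * r + 1 < p.2.length := by exact_mod_cast hlt
        -- The arriving client is not yet accepted; this turns `β ^ r * n ≤ 1` into the strict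
        -- inequality needed.
        have hA : (#(accepted σ P t) : ℝ) < n := by
          have h := (card_accepted_le (σ := σ) (P := P) t).trans_lt t.isLt
          exact_mod_cast h
        have hA' : β ^ r * #(accepted σ P t) < 1 :=
          (mul_lt_mul_of_pos_left hA (by positivity)).trans_le hr
        rw [accepted_succ_of_eq_some hp, surplus_insert notMem_accepted_self
          fun s hs => hrun.mem_of_long h0 hp hlt' hA' hT hs]
        have hcard : #{i : Fin n | i.val < t.val + 1 ∧ i ∈ longTimes P (2 * r + 1)} ≤
            #{i : Fin n | i.val < t.val ∧ i ∈ longTimes P (2 * r + 1)} + 1 := by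
          refine (Finset.card_le_card ?_).trans (Finset.card_insert_le t _)
          intro i hi
          simp only [mem_insert, mem_filter, mem_univ, true_and] at hi ⊢
          by_cases h3 : i = t
          · exact Or.inl h3
          · have : i.val ≠ t.val := fun h4 => h3 (Fin.ext h4)
            exact Or.inr ⟨by omega, hi.2⟩
        have hcard' : (#{i : Fin n | i.val < t.val + 1 ∧ i ∈ longTimes P (2 * r + 1)} : ℝ) ≤
            #{i : Fin n | i.val < t.val ∧ i ∈ longTimes P (2 * r + 1)} + 1 := by
          exact_mod_cast hcard
        linarith
      · have heq : #{i : Fin n | i.val < t.val + 1 ∧ i ∈ longTimes P (2 * r + 1)} ≤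
            #{i : Fin n | i.val < t.val ∧ i ∈ longTimes P (2 * r + 1)} := by
          refine Finset.card_le_card ?_
          intro i hi
          simp only [mem_filter, mem_univ, true_and] at hi ⊢
          have : i.val ≠ t.val := fun h4 => hlong (Fin.ext h4 ▸ hi.2)
          exact ⟨by omega, hi.2⟩
        have hsub : accepted σ P t ⊆ accepted σ P (t + 1) := by
          intro c hc
          obtain ⟨i, rfl⟩ := σ.surjective c
          rw [mem_accepted] at hc ⊢
          exact ⟨by omega, hc.2⟩
        have := surplus_mono (E := E) (β := β) hsub T
        have heq' : (#{i : Fin n | i.val < t.val + 1 ∧ i ∈ longTimes P (2 * r + 1)} : ℝ) ≤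
            #{i : Fin n | i.val < t.val ∧ i ∈ longTimes P (2 * r + 1)} := by
          exact_mod_cast heq
        linarith
  obtain ⟨T, hT⟩ := key (Fin.last n)
  obtain ⟨m, hinj, hE, -⟩ := hrun.exists_matching (Fin.last n)
  have hcard : (longTimes P (2 * r + 1)).ncard =
      #{t : Fin n | t.val < (Fin.last n).val ∧ t ∈ longTimes P (2 * r + 1)} := by
    rw [← Set.ncard_coe_finset]
    congr 1
    ext t
    simp
  rw [hcard]
  have hA : (#(accepted σ P (Fin.last n)) : ℝ) ≤ n := by
    exact_mod_cast card_accepted_le (σ := σ) (P := P) n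
  calc _ ≤ _ := hT
    _ ≤ (1 - β) * #(accepted σ P (Fin.last n)) := surplus_le h0.le h1 hinj hE T
    _ ≤ _ := mul_le_mul_of_nonneg_left hA (by linarith)

/-- The first arriving client never uses a path longer than `1`. -/
lemma IsSAPRun.val_ne_zero_of_mem_longTimes [Nonempty S] [Finite S] (hrun : IsSAPRun E σ M P)
    {t : Fin n} (ht : t ∈ longTimes P 1) : t.val ≠ 0 := by
  classical
  have := Fintype.ofFinite S
  intro h0
  obtain ⟨p, hp, hlt⟩ := ht
  have hA : accepted σ P t = ∅ :=
    Finset.card_eq_zero.1 (Nat.le_zero.1 (h0 ▸ card_accepted_le (σ := σ) (P := P) t.val))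
  have hlt' : 2 * 0 + 1 < p.2.length := by exact_mod_cast hlt
  have hE : ∃ s, E (σ t) s := by
    obtain ⟨v, q⟩ := p
    cases q with
    | @cons _ w _ h q =>
      rcases w with c | s
      · exact h.elim
      · exact ⟨s, h.2⟩
  obtain ⟨s, hs⟩ := hE
  -- With no accepted client, `∅` has maximum surplus for `β = 1`, and `r = 0` is allowed.
  have := hrun.mem_of_long one_pos hp hlt' (by simp [hA]) (T := ∅)
    (by simp [hA, surplus]) hs
  simp at this

lemma IsSAPRun.ncard_longTimes_one_le [Nonempty S] [Finite S] (hrun : IsSAPRun E σ M P) :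
    (longTimes P 1).ncard ≤ n - 1 := by
  classical
  rcases n with _ | n
  · simp [Set.eq_empty_of_isEmpty]
  have hsub : longTimes P 1 ⊆ {(0 : Fin (n + 1))}ᶜ := by
    intro t ht h0
    rw [Set.mem_singleton_iff] at h0
    exact hrun.val_ne_zero_of_mem_longTimes ht (by rw [h0]; rfl)
  refine (Set.ncard_le_ncard hsub).trans ?_
  rw [Set.ncard_compl]
  simp

end Run

/-! ### Choice of parameters and conclusion. -/

/-- The numerical part of the estimate, for thresholds at least `3`. -/
lemma exists_growth_rate {n : ℕ} (hn : 2 ≤ n) {h : ℝ} (h3 : 3 ≤ h) (hlog : 4 * Real.log n < h) :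
    ∃ (β : ℝ) (r : ℕ), 0 < β ∧ β ≤ 1 ∧ β ^ r * n ≤ 1 ∧ 2 * (r : ℝ) + 1 ≤ h ∧
      1 - β ≤ 4 * Real.log n / h := by
  have hn0 : (0 : ℝ) < n := by positivity
  have hlogpos : 0 ≤ Real.log n := Real.log_natCast_nonneg n
  have hlog2 := Real.log_two_gt_d9
  by_cases h5 : h < 5
  -- Here `r = 1` and `β = 1 / n`; since `4 * log 4 > 5`, only `n = 2` and `n = 3` remain.
  · have hn4 : n < 4 := by
      by_contra hn4
      have : Real.log 4 ≤ Real.log n := Real.log_le_log (by norm_num) (by exact_mod_cast not_lt.1 hn4)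
      have h4 : Real.log 4 = 2 * Real.log 2 := by
        rw [show (4 : ℝ) = 2 ^ 2 by norm_num, Real.log_pow]; norm_num
      linarith
    refine ⟨(n : ℝ)⁻¹, 1, by positivity, inv_le_one_of_one_le₀ (by exact_mod_cast (by omega)),
      by rw [pow_one, inv_mul_cancel₀ hn0.ne'], by norm_num; exact h3, ?_⟩
    rw [le_div_iff₀ (by linarith)]
    interval_cases n
    · norm_num; linarith
    · have hlog3 : 1 ≤ Real.log 3 := by
        rw [Real.le_log_iff_exp_le (by norm_num)]
        exact Real.exp_one_lt_d9.le.trans (by norm_num)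
      norm_num
      linarith
  · push Not at h5
    have hr := Nat.floor_le (show 0 ≤ (h - 1) / 2 by linarith)
    have hr' := Nat.lt_floor_add_one ((h - 1) / 2)
    have hr2 : 2 ≤ ⌊(h - 1) / 2⌋₊ := Nat.le_floor (by push_cast; linarith)
    set r := ⌊(h - 1) / 2⌋₊
    have hr2' : (2 : ℝ) ≤ r := by exact_mod_cast hr2
    refine ⟨Real.exp (-(Real.log n / r)), r, Real.exp_pos _,
      Real.exp_le_one_iff.2 (neg_nonpos.2 (by positivity)), ?_, by linarith, ?_⟩
    · rw [← Real.exp_nat_mul, mul_neg, mul_div_cancel₀ _ (by positivity), Real.exp_neg,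
        Real.exp_log hn0, inv_mul_cancel₀ hn0.ne']
    · have h1 := Real.add_one_le_exp (-(Real.log n / r))
      -- This needs `h ≤ 4 * r`, which follows from `r ≥ 2` if `h ≤ 8` and from `r > (h - 3) / 2`
      -- otherwise.
      have h2 : Real.log n / r ≤ 4 * Real.log n / h := by
        rw [div_le_div_iff₀ (by linarith) (by linarith)]
        nlinarith
      linarith

end OnlineMatching

theorem mainTheorem2 {C S : Type*} [Finite S] {n : ℕ} (E : C → S → Prop) (σ : Fin n ≃ C)
    (M : Fin (n + 1) → Set (Sym2 (C ⊕ S)))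
    (P : (t : Fin n) →
      Option (OnlineMatching.PathFrom (OnlineMatching.currentGraph E σ t) (σ t)))
    (hrun : OnlineMatching.IsSAPRun E σ M P)
    (h : ℝ) (hpos : 0 < h) (hone : n = 1 → 1 ≤ h) :
    (({t : Fin n | ∃ p, P t = some p ∧ h < (p.2.length : ℝ)}.ncard : ℕ) : ℝ) ≤
      4 * (n : ℝ) * Real.log (n : ℝ) / h := by
  change ((OnlineMatching.longTimes P h).ncard : ℝ) ≤ _
  have hlogpos : 0 ≤ Real.log n := Real.log_natCast_nonneg n
  rcases isEmpty_or_nonempty S with hS | hS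
  · have : OnlineMatching.longTimes P h = ∅ :=
      Set.eq_empty_of_forall_notMem fun t ⟨p, _⟩ => hS.elim p.1
    rw [this]
    simpa using by positivity
  rcases Nat.lt_or_ge n 2 with hn | hn
  -- The claimed bound is zero here; for `n = 1` the hypothesis `1 ≤ h` excludes the single-edge
  -- path.
  · have hcard : (OnlineMatching.longTimes P h).ncard = 0 := by
      interval_cases n
      · simp [Set.eq_empty_of_isEmpty]
      · exact Nat.le_zero.1 ((Set.ncard_le_ncard (OnlineMatching.longTimes_anti (hone rfl))).trans
          hrun.ncard_longTimes_one_le)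
    rw [hcard, Nat.cast_zero]
    positivity
  have hn0 : (0 : ℝ) < n := by positivity
  rw [mul_comm 4 (n : ℝ), mul_assoc, mul_div_assoc]
  -- For `h ≤ 4 * log n` the claimed bound is at least the number `n` of arrivals.
  rcases le_or_gt h (4 * Real.log n) with hsmall | hlog
  · have hcard : (OnlineMatching.longTimes P h).ncard ≤ n :=
      (Set.ncard_le_card _).trans (by simp)
    calc ((OnlineMatching.longTimes P h).ncard : ℝ) ≤ n := by exact_mod_cast hcard
      _ ≤ n * (4 * Real.log n / h) :=
        le_mul_of_one_le_right hn0.le ((one_le_div hpos).2 hsmall)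
  rcases lt_or_ge h 3 with h3 | h3
  -- Now `4 * log n < h < 3` forces `n = 2`. Only the second client can use a path longer than `1`,
  -- and `8 * log 2 > 3 > h`.
  · have hlog2 := Real.log_two_gt_d9
    have hlog2n : Real.log 2 ≤ Real.log n := Real.log_le_log (by norm_num) (by exact_mod_cast hn)
    have hn3 : n < 3 := by
      by_contra hn3
      have hlog3 : 1 ≤ Real.log n := by
        rw [Real.le_log_iff_exp_le hn0]
        have : (3 : ℝ) ≤ n := by exact_mod_cast not_lt.1 hn3
        exact Real.exp_one_lt_d9.le.trans (by linarith)
      linarith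
    have hcard := (Set.ncard_le_ncard (OnlineMatching.longTimes_anti (P := P)
      (show (1 : ℝ) ≤ h by linarith))).trans hrun.ncard_longTimes_one_le
    obtain rfl : n = 2 := by omega
    calc ((OnlineMatching.longTimes P h).ncard : ℝ) ≤ 1 := by exact_mod_cast hcard
      _ ≤ _ := by
        rw [← mul_div_assoc, one_le_div hpos]
        push_cast
        linarith
  · obtain ⟨β, r, h0, h1, hr, hrh, hle⟩ := OnlineMatching.exists_growth_rate hn h3 hlog
    have hcard := Set.ncard_le_ncard (OnlineMatching.longTimes_anti (P := P) hrh)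
    calc ((OnlineMatching.longTimes P h).ncard : ℝ)
        ≤ (OnlineMatching.longTimes P (2 * r + 1)).ncard := by exact_mod_cast hcard
      _ ≤ (1 - β) * n := hrun.ncard_longTimes_le h0 h1 hr
      _ ≤ n * (4 * Real.log n / h) := by
        rw [mul_comm]
        exact mul_le_mul_of_nonneg_left hle hn0.le
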